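/- Let $p,q$ be odd primes with $p\mid q-1$, let $n\in(\mathbb Z/q)^\times$ with $n\ne1$, $n^p=1$, and let $$G=\mathbb Z/q\rtimes\mathbb Z/p=\langle a,b\mid a^q=b^p=1,\ bab^{-1}=a^n\rangle .$$ Let $[i]\in\{0,\dots,p-1\}$ denote the representative of $i$ modulo $p$. Let $\omega$ be the $3$-cocycle on $G$ inflated along $G\to\langle b\rangle$ from $$\omega(b^i,b^j,b^k)=\exp\Bigl(\tfrac{2\pi i}{p^2}[i]\bigl([j]+[k]-[j+k]\bigr)\Bigr)$$ (where the $i$ in $2\pi i$ is the imaginary unit), and let $u\in\mathbb Z$. Let $\mathrm{Vect}_G^{\omega^u}$ be the category of finite-dimensional $G$-graded complex vector spaces, with associativity isomorphisms given on homogeneous elements by $$U\otimes(V\otimes W)\to(U\otimes V)\otimes W,\qquad x\otimes(y\otimes z)\mapsto\omega^u(|x|,|y|,|z|)\,(x\otimes y)\otimes z .$$ Let $\mathcal Z=\mathcal Z(\mathrm{Vect}_G^{\omega^u})$ be its right Drinfeld center: objects are pairs $(W,\sigma_{\cdot,W})$ with half-braidings $\sigma_{V,W}:V\otimes W\to W\otimes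 V$. Such a half-braiding has the form $v\otimes w\mapsto(|v|\triangleright w)\otimes v$, where $$x\triangleright y\triangleright w=\alpha^u_{|w|}(x,y)\,xy\triangleright w,\qquad \alpha^u_g(x,y)=\omega^u(x,y,g)\,\omega^u(x,ygy^{-1},y)^{-1}\,\omega^u(xyg(xy)^{-1},x,y).$$ A simple object of $\mathcal Z$ is denoted $(g,\chi)$ if its degree-$g$ component is nonzero and affords, under the action of $C_G(g)$, the $\alpha^u_g$-projective character $\chi$. The twist $\Theta$ of a simple object $W$ is the scalar with $\operatorname{tr}(\sigma_{W,W})=\Theta\cdot\dim W$, where $\operatorname{tr}$ is the pivotal trace, i.e. the usual trace of the underlying linear map. Let $\chi_q(a)=e^{2\pi i/q}$ and $\chi_p(b)=e^{2\pi i/p}$. For $k\in\{1,\dots,p-1\}$ and $r\in\mathbb Z$ write $(b^k,\chi_p^r)$ for the simple object $(b^k,\chi_p^r\mu_k)$, where $\mu_k(b^j)=\exp\bigl(\tfrac{2\pi i}{p^2}uk[j]\bigr)$; this satisfies $\alpha^u_{b^k}(x,y)=\mu_k(x)\mu_k(y)/\mu_k(xy)$ on $C_G(b^k)=\langle b\rangle$.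 Then the twists of the simple objects of $\mathcal Z$ are as follows. \begin{enumerate} \item $\Theta(1,\chi)=1$ for every irreducible character $\chi$ of $G$. \item $\Theta(a^l,\chi_q^s)=\exp\bigl(\tfrac{2\pi i}{q}sl\bigr)$ for all $s\in\mathbb Z$ and all integers $l\ge0$ not divisible by $q$. \item $\Theta(b^k,\chi_p^r)=\exp\bigl(\tfrac{2\pi i}{p^2}(pkr+k^2u)\bigr)$ for all $k\in\{1,\dots,p-1\}$ and $r\in\mathbb Z$. \item In particular $\Theta(b^k,\chi_p^r)^p=\zeta_p^{k^2u}$ with $\zeta_p=e^{2\pi i/p}$. \end{enumerate} -/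

import Mathlib

open CategoryTheory MonoidalCategory TensorProduct

noncomputable section

/-- A normalized three-cocycle on `G` with values in `ℂˣ` (trivial action). The condition on the
middle argument implies that `toFun` is `1` whenever one of its arguments is `1`. -/
structure ThreeCocycle (G : Type) [Group G] where
  toFun : G → G → G → ℂˣ
  cocycle : ∀ x y z w, toFun y z w * toFun x (y * z) w * toFun x y z =
    toFun (x * y) z w * toFun x y (z * w)
  normalized : ∀ x y, toFun x 1 y = 1

/-- A finite-dimensional `G`-graded complex vector space; the grading is given by the projections
`proj g` onto the homogeneous components. The cocycle `ω` enters only in the associativity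
constraint of the category. -/
structure VecG {G : Type} [Group G] [Fintype G] (ω : ThreeCocycle G) where
  carrier : Type
  [addCommGroup : AddCommGroup carrier]
  [module : Module ℂ carrier]
  [finiteDimensional : FiniteDimensional ℂ carrier]
  proj : G → Module.End ℂ carrier
  isProj : CompleteOrthogonalIdempotents proj

/-- The two-cochain `α_g`, where `y ⊳ g = y g y⁻¹`:
`α_g(x, y) = ω(x, y, g) ω(x, y ⊳ g, y)⁻¹ ω(x y ⊳ g, x, y)`. -/
def ThreeCocycle.alpha {G : Type} [Group G] (ω : ThreeCocycle G) (g x y : G) : ℂˣ :=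
  ω.toFun x y g * (ω.toFun x (y * g * y⁻¹) y)⁻¹ * ω.toFun (x * y * g * (x * y)⁻¹) x y

namespace VecG

variable {G : Type} [Group G] [Fintype G] {ω : ThreeCocycle G}

attribute [instance] addCommGroup module finiteDimensional

/-- `v` is homogeneous of degree `g`. -/
def IsHomog (V : VecG ω) (g : G) (v : V.carrier) : Prop := V.proj g v = v

theorem isHomog_proj (V : VecG ω) (g : G) (v : V.carrier) : V.IsHomog g (V.proj g v) := by
  have := V.isProj.idem g
  exact LinearMap.congr_fun this v

theorem IsHomog.proj_ne {V : VecG ω} {g h : G} {v : V.carrier} (hv : V.IsHomog g v) (hh : h ≠ g) :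
    V.proj h v = 0 := by
  have := V.isProj.ortho hh
  rw [← hv]
  exact LinearMap.congr_fun this v

theorem sum_proj (V : VecG ω) (v : V.carrier) : ∑ g, V.proj g v = v := by
  have := LinearMap.congr_fun V.isProj.complete v
  simpa using this

/-- Linear maps that agree on homogeneous elements are equal. -/
theorem linext {V : VecG ω} {M : Type*} [AddCommMonoid M] [Module ℂ M] {f g : V.carrier →ₗ[ℂ] M}
    (H : ∀ x v, V.IsHomog x v → f v = g v) : f = g := by
  ext v
  rw [← V.sum_proj v, map_sum, map_sum]
  exact Finset.sum_congr rfl fun x _ => H x _ (V.isHomog_proj x v)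

/-- A morphism: a linear map that preserves degrees. -/
@[ext]
structure Hom (V W : VecG ω) where
  lin : V.carrier →ₗ[ℂ] W.carrier
  comm : ∀ g, lin ∘ₗ V.proj g = W.proj g ∘ₗ lin

/-- A linear map is a morphism if it preserves the degree of every homogeneous element. -/
def Hom.mk' {V W : VecG ω} (f : V.carrier →ₗ[ℂ] W.carrier)
    (H : ∀ x v, V.IsHomog x v → W.IsHomog x (f v)) : Hom V W where
  lin := f
  comm g := by
    refine linext fun x v hv => ?_
    by_cases h : g = x
    · subst h
      simp only [LinearMap.comp_apply]
      rw [show V.proj g v = v from hv, show W.proj g (f v) = f v from H _ _ hv]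
    · simp only [LinearMap.comp_apply]
      rw [hv.proj_ne h, (H _ _ hv).proj_ne h, map_zero]

instance : Category (VecG ω) where
  Hom := Hom
  id V := ⟨LinearMap.id, fun _ => rfl⟩
  comp f g := ⟨g.lin ∘ₗ f.lin, fun x => by
    rw [LinearMap.comp_assoc, f.comm, ← LinearMap.comp_assoc, g.comm, LinearMap.comp_assoc]⟩

@[ext]
theorem hom_ext {V W : VecG ω} {f g : V ⟶ W} (h : f.lin = g.lin) : f = g := Hom.ext h

@[simp] theorem id_lin (V : VecG ω) : Hom.lin (𝟙 V) = LinearMap.id := rfl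
@[simp] theorem comp_lin {U V W : VecG ω} (f : U ⟶ V) (g : V ⟶ W) :
    Hom.lin (f ≫ g) = g.lin ∘ₗ f.lin := rfl

theorem IsHomog.map {V W : VecG ω} (f : V ⟶ W) {x : G} {v : V.carrier} (hv : V.IsHomog x v) :
    W.IsHomog x (f.lin v) := by
  have := LinearMap.congr_fun (f.comm x) v
  simp only [LinearMap.comp_apply] at this
  rw [show V.proj x v = v from hv] at this
  exact this.symm

/-- The tensor product: `(V ⊗ W)_g = ⨁_x V_x ⊗ W_{x⁻¹ g}`. -/
abbrev tensor (V W : VecG ω) : VecG ω where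
  carrier := V.carrier ⊗[ℂ] W.carrier
  proj g := ∑ x, TensorProduct.map (V.proj x) (W.proj (x⁻¹ * g))
  isProj := by
    classical
    have key : ∀ x y : G, ∀ v w, V.IsHomog x v → W.IsHomog y w → ∀ g,
        (∑ a, TensorProduct.map (V.proj a) (W.proj (a⁻¹ * g))) (v ⊗ₜ[ℂ] w) =
          if g = x * y then v ⊗ₜ[ℂ] w else 0 := by
      intro x y v w hv hw g
      rw [LinearMap.sum_apply, Finset.sum_eq_single x]
      · rw [TensorProduct.map_tmul, show V.proj x v = v from hv]
        split_ifs with h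
        · rw [h, inv_mul_cancel_left, show W.proj y w = w from hw]
        · rw [hw.proj_ne (fun h' => h (by rw [← h', mul_inv_cancel_left])), tmul_zero]
      · intro b _ hb
        rw [TensorProduct.map_tmul, hv.proj_ne hb, zero_tmul]
      · simp
    have ext2 : ∀ f g : Module.End ℂ (V.carrier ⊗[ℂ] W.carrier),
        (∀ x y v w, V.IsHomog x v → W.IsHomog y w → f (v ⊗ₜ[ℂ] w) = g (v ⊗ₜ[ℂ] w)) → f = g := by
      intro f g H
      apply TensorProduct.ext
      refine linext fun x v hv => linext fun y w hw => ?_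
      exact H x y v w hv hw
    rw [CompleteOrthogonalIdempotents.iff_ortho_complete]
    constructor
    · intro g h hgh
      refine ext2 _ _ fun x y v w hv hw => ?_
      show (∑ a, TensorProduct.map (V.proj a) (W.proj (a⁻¹ * g)))
        ((∑ a, TensorProduct.map (V.proj a) (W.proj (a⁻¹ * h))) (v ⊗ₜ[ℂ] w)) = 0
      rw [key x y v w hv hw]
      split_ifs with h1
      · rw [key x y v w hv hw, if_neg (by rw [← h1]; exact hgh)]
      · exact map_zero _
    · refine ext2 _ _ fun x y v w hv hw => ?_
      rw [LinearMap.sum_apply]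
      simp only [key x y v w hv hw]
      simp

theorem IsHomog.tmul {V W : VecG ω} {x y : G} {v : V.carrier} {w : W.carrier}
    (hv : V.IsHomog x v) (hw : W.IsHomog y w) : (tensor V W).IsHomog (x * y) (v ⊗ₜ[ℂ] w) := by
  show (∑ a, TensorProduct.map (V.proj a) (W.proj (a⁻¹ * (x * y)))) (v ⊗ₜ[ℂ] w) = _
  rw [LinearMap.sum_apply, Finset.sum_eq_single x]
  · rw [TensorProduct.map_tmul, show V.proj x v = v from hv, inv_mul_cancel_left,
      show W.proj y w = w from hw]
  · intro b _ hb
    rw [TensorProduct.map_tmul, hv.proj_ne hb, zero_tmul]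
  · simp

theorem linext₂ {U V : VecG ω} {M : Type*} [AddCommMonoid M] [Module ℂ M]
    {f g : U.carrier ⊗[ℂ] V.carrier →ₗ[ℂ] M}
    (H : ∀ x y u v, U.IsHomog x u → V.IsHomog y v → f (u ⊗ₜ v) = g (u ⊗ₜ v)) : f = g :=
  TensorProduct.ext <| linext fun x u hu => linext fun y v hv => H x y u v hu hv

/-- The one-dimensional space `ℂ` in degree `x`. -/
abbrev single (ω : ThreeCocycle G) (x : G) : VecG ω where
  carrier := ℂ
  proj g := open Classical in if g = x then 1 else 0
  isProj := by
    classical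
    rw [CompleteOrthogonalIdempotents.iff_ortho_complete]
    constructor
    · intro g h hgh
      by_cases h1 : g = x <;> by_cases h2 : h = x <;> simp_all
    · simp

open Classical in
theorem isHomog_single (x : G) (c : ℂ) : (single ω x).IsHomog x c := by
  show (if x = x then (1 : Module.End ℂ ℂ) else 0) c = c
  rw [if_pos rfl, Module.End.one_apply]

open Classical in
theorem isHomog_single_eq {x y : G} {c : ℂ} (h : (single ω x).IsHomog y c) : c = 0 ∨ y = x := by
  by_cases hy : y = x
  · exact Or.inr hy
  · left
    have : (if y = x then (1 : Module.End ℂ ℂ) else 0) c = c := h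
    rw [if_neg hy] at this
    exact this.symm

/-- The tensor product of morphisms. -/
def tensorMap {U U' V V' : VecG ω} (f : U ⟶ U') (g : V ⟶ V') : tensor U V ⟶ tensor U' V' where
  lin := TensorProduct.map f.lin g.lin
  comm a := by
    show _ ∘ₗ (∑ x, TensorProduct.map (U.proj x) (V.proj (x⁻¹ * a))) =
      (∑ x, TensorProduct.map (U'.proj x) (V'.proj (x⁻¹ * a))) ∘ₗ _
    refine TensorProduct.ext' fun u v => ?_
    simp only [LinearMap.comp_apply, LinearMap.sum_apply, TensorProduct.map_tmul, map_sum]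
    refine Finset.sum_congr rfl fun x _ => ?_
    have h1 := LinearMap.congr_fun (f.comm x) u
    have h2 := LinearMap.congr_fun (g.comm (x⁻¹ * a)) v
    simp only [LinearMap.comp_apply] at h1 h2
    rw [h1, h2]

/-- The linear map `u ⊗ (v ⊗ w) ↦ ω(|u|, |v|, |w|) (u ⊗ v) ⊗ w`. -/
def assocInvLin (U V W : VecG ω) : U.carrier ⊗[ℂ] (V.carrier ⊗[ℂ] W.carrier) →ₗ[ℂ]
    (U.carrier ⊗[ℂ] V.carrier) ⊗[ℂ] W.carrier :=
  ∑ x, ∑ y, ∑ z, (ω.toFun x y z : ℂ) • (TensorProduct.assoc ℂ _ _ _).symm.toLinearMap ∘ₗ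
    TensorProduct.map (U.proj x) (TensorProduct.map (V.proj y) (W.proj z))

/-- The linear map `(u ⊗ v) ⊗ w ↦ ω(|u|, |v|, |w|)⁻¹ u ⊗ (v ⊗ w)`. -/
def assocHomLin (U V W : VecG ω) : (U.carrier ⊗[ℂ] V.carrier) ⊗[ℂ] W.carrier →ₗ[ℂ]
    U.carrier ⊗[ℂ] (V.carrier ⊗[ℂ] W.carrier) :=
  ∑ x, ∑ y, ∑ z, ((ω.toFun x y z)⁻¹ : ℂ) • (TensorProduct.assoc ℂ _ _ _).toLinearMap ∘ₗ
    TensorProduct.map (TensorProduct.map (U.proj x) (V.proj y)) (W.proj z)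

variable {U V W : VecG ω} {x y z : G} {u : U.carrier} {v : V.carrier} {w : W.carrier}

theorem assocInvLin_apply (hu : U.IsHomog x u) (hv : V.IsHomog y v) (hw : W.IsHomog z w) :
    assocInvLin U V W (u ⊗ₜ (v ⊗ₜ w)) = (ω.toFun x y z : ℂ) • ((u ⊗ₜ v) ⊗ₜ w) := by
  unfold assocInvLin
  simp only [LinearMap.sum_apply, LinearMap.smul_apply, LinearMap.comp_apply,
    TensorProduct.map_tmul, LinearEquiv.coe_coe, TensorProduct.assoc_symm_tmul]
  rw [Finset.sum_eq_single x, Finset.sum_eq_single y, Finset.sum_eq_single z]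
  · rw [show U.proj x u = u from hu, show V.proj y v = v from hv, show W.proj z w = w from hw]
  · intro b _ hb; rw [hw.proj_ne hb]; simp
  · simp
  · intro b _ hb; rw [hv.proj_ne hb]; simp
  · simp
  · intro b _ hb; rw [hu.proj_ne hb]; simp
  · simp

theorem assocHomLin_apply (hu : U.IsHomog x u) (hv : V.IsHomog y v) (hw : W.IsHomog z w) :
    assocHomLin U V W ((u ⊗ₜ v) ⊗ₜ w) = ((ω.toFun x y z)⁻¹ : ℂ) • (u ⊗ₜ (v ⊗ₜ w)) := by
  unfold assocHomLin
  simp only [LinearMap.sum_apply, LinearMap.smul_apply, LinearMap.comp_apply,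
    TensorProduct.map_tmul, LinearEquiv.coe_coe, TensorProduct.assoc_tmul]
  rw [Finset.sum_eq_single x, Finset.sum_eq_single y, Finset.sum_eq_single z]
  · rw [show U.proj x u = u from hu, show V.proj y v = v from hv, show W.proj z w = w from hw]
  · intro b _ hb; rw [hw.proj_ne hb]; simp
  · simp
  · intro b _ hb; rw [hv.proj_ne hb]; simp
  · simp
  · intro b _ hb; rw [hu.proj_ne hb]; simp
  · simp

theorem linext₃ {M : Type*} [AddCommMonoid M] [Module ℂ M]
    {f g : (U.carrier ⊗[ℂ] V.carrier) ⊗[ℂ] W.carrier →ₗ[ℂ] M}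
    (H : ∀ x y z u v w, U.IsHomog x u → V.IsHomog y v → W.IsHomog z w →
      f ((u ⊗ₜ v) ⊗ₜ w) = g ((u ⊗ₜ v) ⊗ₜ w)) : f = g :=
  TensorProduct.ext <| linext₂ fun x y u v hu hv => linext fun z w hw => H x y z u v w hu hv hw

theorem linext₃' {M : Type*} [AddCommMonoid M] [Module ℂ M]
    {f g : U.carrier ⊗[ℂ] (V.carrier ⊗[ℂ] W.carrier) →ₗ[ℂ] M}
    (H : ∀ x y z u v w, U.IsHomog x u → V.IsHomog y v → W.IsHomog z w →
      f (u ⊗ₜ (v ⊗ₜ w)) = g (u ⊗ₜ (v ⊗ₜ w))) : f = g :=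
  TensorProduct.ext <| linext fun x u hu => linext₂ fun y z v w hv hw => H x y z u v w hu hv hw

theorem proj_tmul [DecidableEq G] (hu : U.IsHomog x u) (hv : V.IsHomog y v) (g : G) :
    (tensor U V).proj g (u ⊗ₜ[ℂ] v) = if g = x * y then u ⊗ₜ[ℂ] v else 0 := by
  split_ifs with h
  · subst h; exact hu.tmul hv
  · exact (hu.tmul hv).proj_ne h

theorem IsHomog.proj_apply [DecidableEq G] (hv : V.IsHomog y v) (g : G) :
    V.proj g v = if g = y then v else 0 := by
  split_ifs with h
  · subst h; exact hv
  · exact hv.proj_ne h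

theorem IsHomog.smul (c : ℂ) (hv : V.IsHomog y v) : V.IsHomog y (c • v) := by
  show V.proj y (c • v) = c • v
  rw [map_smul, show V.proj y v = v from hv]

/-- The associativity constraint, with inverse `u ⊗ (v ⊗ w) ↦ ω(|u|, |v|, |w|) (u ⊗ v) ⊗ w`. -/
def assoc (U V W : VecG ω) : tensor (tensor U V) W ≅ tensor U (tensor V W) where
  hom :=
    { lin := assocHomLin U V W
      comm := fun g => by
        classical
        refine linext₃ fun x y z u v w hu hv hw => ?_
        show assocHomLin U V W ((tensor (tensor U V) W).proj g ((u ⊗ₜ v) ⊗ₜ w)) =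
          (tensor U (tensor V W)).proj g (assocHomLin U V W ((u ⊗ₜ v) ⊗ₜ w))
        have h1 : (tensor U (tensor V W)).IsHomog (x * y * z)
            (assocHomLin U V W ((u ⊗ₜ v) ⊗ₜ w)) := by
          rw [assocHomLin_apply hu hv hw, mul_assoc]
          exact IsHomog.smul _ (hu.tmul (hv.tmul hw))
        have h2 := IsHomog.tmul (V := tensor U V) (hu.tmul hv) hw
        rw [h1.proj_apply]
        by_cases h : g = x * y * z
        · rw [if_pos h, h]; exact congrArg _ h2
        · rw [if_neg h]; exact (congrArg _ (h2.proj_ne h)).trans (map_zero _) }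
  inv :=
    { lin := assocInvLin U V W
      comm := fun g => by
        classical
        refine linext₃' fun x y z u v w hu hv hw => ?_
        show assocInvLin U V W ((tensor U (tensor V W)).proj g (u ⊗ₜ (v ⊗ₜ w))) =
          (tensor (tensor U V) W).proj g (assocInvLin U V W (u ⊗ₜ (v ⊗ₜ w)))
        have h1 : (tensor (tensor U V) W).IsHomog (x * (y * z))
            (assocInvLin U V W (u ⊗ₜ (v ⊗ₜ w))) := by
          rw [assocInvLin_apply hu hv hw, ← mul_assoc]
          exact IsHomog.smul _ ((hu.tmul hv).tmul hw)
        have h2 := IsHomog.tmul (W := tensor V W) hu (hv.tmul hw)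
        rw [h1.proj_apply]
        by_cases h : g = x * (y * z)
        · rw [if_pos h, h]; exact congrArg _ h2
        · rw [if_neg h]; exact (congrArg _ (h2.proj_ne h)).trans (map_zero _) }
  hom_inv_id := by
    apply hom_ext
    refine linext₃ fun x y z u v w hu hv hw => ?_
    show assocInvLin U V W (assocHomLin U V W _) = _
    rw [assocHomLin_apply hu hv hw, map_smul, assocInvLin_apply hu hv hw, smul_smul,
      inv_mul_cancel₀ (Units.ne_zero _), one_smul]
    rfl
  inv_hom_id := by
    apply hom_ext
    refine linext₃' fun x y z u v w hu hv hw => ?_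
    show assocHomLin U V W (assocInvLin U V W _) = _
    rw [assocInvLin_apply hu hv hw, map_smul, assocHomLin_apply hu hv hw, smul_smul,
      mul_inv_cancel₀ (Units.ne_zero _), one_smul]
    rfl

/-- An isomorphism from a degree-preserving linear equivalence. -/
def isoOfEquiv {V W : VecG ω} (e : V.carrier ≃ₗ[ℂ] W.carrier)
    (H : ∀ g, e.toLinearMap ∘ₗ V.proj g = W.proj g ∘ₗ e.toLinearMap) : V ≅ W where
  hom := ⟨e.toLinearMap, H⟩
  inv := ⟨e.symm.toLinearMap, fun g => by
    apply LinearMap.ext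
    intro w
    apply e.injective
    have := LinearMap.congr_fun (H g) (e.symm w)
    simp only [LinearMap.comp_apply, LinearEquiv.coe_coe, LinearEquiv.apply_symm_apply] at this ⊢
    exact this.symm⟩
  hom_inv_id := by apply hom_ext; ext v; exact e.symm_apply_apply v
  inv_hom_id := by apply hom_ext; ext v; exact e.apply_symm_apply v

/-- The left unit constraint `c ⊗ v ↦ c v`. -/
def leftUnit (V : VecG ω) : tensor (single ω 1) V ≅ V :=
  isoOfEquiv (W := V) (V := tensor (single ω 1) V) (TensorProduct.lid ℂ V.carrier) fun g => by
    classical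
    refine linext₂ (U := single ω 1) fun x y (u : ℂ) v hu hv => ?_
    show TensorProduct.lid ℂ V.carrier ((tensor (single ω 1) V).proj g (u ⊗ₜ v)) =
      V.proj g (u • v)
    rw [map_smul, hv.proj_apply]
    rcases isHomog_single_eq hu with rfl | rfl
    · erw [zero_tmul, map_zero]
      exact (map_zero _).trans (zero_smul _ _).symm
    · erw [proj_tmul hu hv]
      rw [one_mul]
      split_ifs
      · rfl
      · rw [smul_zero]; exact map_zero _

/-- The right unit constraint `v ⊗ c ↦ c v`. -/
def rightUnit (V : VecG ω) : tensor V (single ω 1) ≅ V :=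
  isoOfEquiv (W := V) (V := tensor V (single ω 1)) (TensorProduct.rid ℂ V.carrier) fun g => by
    classical
    refine linext₂ (V := single ω 1) fun x y v (u : ℂ) hv hu => ?_
    show TensorProduct.rid ℂ V.carrier ((tensor V (single ω 1)).proj g (v ⊗ₜ u)) =
      V.proj g (u • v)
    rw [map_smul, hv.proj_apply]
    rcases isHomog_single_eq hu with rfl | rfl
    · erw [tmul_zero, map_zero]
      exact (map_zero _).trans (zero_smul _ _).symm
    · erw [proj_tmul hv hu]
      rw [mul_one]
      split_ifs
      · rfl
      · rw [smul_zero]; exact map_zero _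

instance : MonoidalCategoryStruct (VecG ω) where
  tensorObj := tensor
  tensorHom := tensorMap
  whiskerLeft V _ _ f := tensorMap (𝟙 V) f
  whiskerRight f V := tensorMap f (𝟙 V)
  tensorUnit := single ω 1
  associator := assoc
  leftUnitor := leftUnit
  rightUnitor := rightUnit

instance : MonoidalCategory (VecG ω) where
  tensorHom_def f g := by
    apply hom_ext
    refine TensorProduct.ext' fun u v => rfl
  id_tensorHom_id V W := by
    apply hom_ext
    refine TensorProduct.ext' fun u v => rfl
  tensorHom_comp_tensorHom f g h k := by
    apply hom_ext
    refine TensorProduct.ext' fun u v => rfl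
  whiskerLeft_id V W := by
    apply hom_ext
    refine TensorProduct.ext' fun u v => rfl
  id_whiskerRight V W := by
    apply hom_ext
    refine TensorProduct.ext' fun u v => rfl
  associator_naturality {U V W U' V' W'} f g h := by
    apply hom_ext
    refine linext₃ fun x y z u v w hu hv hw => ?_
    show assocHomLin U' V' W' ((f.lin u ⊗ₜ g.lin v) ⊗ₜ h.lin w) =
      TensorProduct.map f.lin (TensorProduct.map g.lin h.lin)
        (assocHomLin U V W ((u ⊗ₜ v) ⊗ₜ w))
    rw [assocHomLin_apply hu hv hw, assocHomLin_apply (hu.map f) (hv.map g) (hw.map h), map_smul]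
    rfl
  leftUnitor_naturality {V W} f := by
    apply hom_ext
    refine TensorProduct.ext' fun (u : ℂ) v => ?_
    show u • f.lin v = f.lin (u • v)
    rw [map_smul]
  rightUnitor_naturality {V W} f := by
    apply hom_ext
    refine TensorProduct.ext' fun v (u : ℂ) => ?_
    show u • f.lin v = f.lin (u • v)
    rw [map_smul]
  pentagon T U V W := by
    apply hom_ext
    refine TensorProduct.ext <| linext₃ fun t x y s u v hs hu hv => linext fun z w hw => ?_
    show TensorProduct.map LinearMap.id (assocHomLin U V W) (assocHomLin T (tensor U V) W
      ((assocHomLin T U V ((s ⊗ₜ u) ⊗ₜ v)) ⊗ₜ w)) =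
      assocHomLin T U (tensor V W) (assocHomLin (tensor T U) V W (((s ⊗ₜ u) ⊗ₜ v) ⊗ₜ w))
    have h1 := assocHomLin_apply hs hu hv
    have h2 := assocHomLin_apply (U := tensor T U) (hs.tmul hu) hv hw
    have h3 := assocHomLin_apply (V := tensor U V) hs (hu.tmul hv) hw
    have h4 := assocHomLin_apply (W := tensor V W) hs hu (hv.tmul hw)
    have h5 := assocHomLin_apply hu hv hw
    rw [h1]
    erw [h2]
    refine Eq.trans (b := (ω.toFun t x y : ℂ)⁻¹ • (ω.toFun t (x * y) z : ℂ)⁻¹ •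
      (ω.toFun x y z : ℂ)⁻¹ • (s ⊗ₜ (u ⊗ₜ (v ⊗ₜ w)))) ?_ (Eq.trans
      (b := (ω.toFun (t * x) y z : ℂ)⁻¹ • (ω.toFun t x (y * z) : ℂ)⁻¹ •
        (s ⊗ₜ (u ⊗ₜ (v ⊗ₜ w)))) ?_ ?_)
    · refine (congrArg (TensorProduct.map LinearMap.id (assocHomLin U V W))
        (map_smul (T.assocHomLin (tensor U V) W) (ω.toFun t x y : ℂ)⁻¹
          ((s ⊗ₜ (u ⊗ₜ v)) ⊗ₜ w))).trans ?_
      refine (congrArg (fun q => TensorProduct.map LinearMap.id (assocHomLin U V W)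
        ((ω.toFun t x y : ℂ)⁻¹ • q)) h3).trans ?_
      refine (map_smul _ _ _).trans (congrArg _ ((map_smul _ _ _).trans (congrArg _ ?_)))
      refine (congrArg (fun q => s ⊗ₜ[ℂ] q) h5).trans ?_
      exact tmul_smul _ _ _
    swap
    · exact ((map_smul (T.assocHomLin U (tensor V W)) _ _).trans (congrArg _ h4)).symm
    rw [smul_smul, smul_smul, smul_smul]
    congr 1
    have := ω.cocycle t x y z
    simp only [← Units.val_inv_eq_inv_val, ← Units.val_mul, ← mul_inv]
    rw [← this]
    congr 2
    ac_rfl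
  triangle V W := by
    apply hom_ext
    refine linext₃ fun x y z v (c : ℂ) w hv hc hw => ?_
    show TensorProduct.map LinearMap.id (TensorProduct.lid ℂ W.carrier).toLinearMap
      (assocHomLin V (single ω 1) W ((v ⊗ₜ c) ⊗ₜ w)) = (c • v) ⊗ₜ w
    rcases isHomog_single_eq hc with rfl | rfl
    · rw [zero_smul, zero_tmul]
      erw [tmul_zero, zero_tmul, map_zero]
      exact map_zero _
    · have h := assocHomLin_apply (V := single ω 1) hv hc hw
      rw [ω.normalized, Units.val_one, inv_one, one_smul] at h
      erw [h]
      rw [smul_tmul]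
      rfl

instance (V W : VecG ω) : Zero (V ⟶ W) := ⟨⟨0, fun _ => by simp⟩⟩

@[simp] theorem zero_lin (V W : VecG ω) : Hom.lin (0 : V ⟶ W) = 0 := rfl

end VecG

/-! ### The right Drinfeld center -/

/-- An object `(W, σ)` of the right Drinfeld center of a monoidal category: `σ` is a half-braiding
`σ_{V,W} : V ⊗ W ≅ W ⊗ V`, natural in `V` and compatible with tensor products in `V`. -/
structure RightCenter (C : Type*) [Category C] [MonoidalCategory C] where
  obj : C
  σ : ∀ V : C, V ⊗ obj ≅ obj ⊗ V
  naturality : ∀ {V V' : C} (f : V ⟶ V'), f ▷ obj ≫ (σ V').hom = (σ V).hom ≫ obj ◁ f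
  hexagon : ∀ U V : C, (σ (U ⊗ V)).hom = (α_ U V obj).hom ≫ U ◁ (σ V).hom ≫
    (α_ U obj V).inv ≫ (σ U).hom ▷ V ≫ (α_ obj U V).hom

namespace RightCenter

section
variable {C : Type*} [Category C] [MonoidalCategory C]

/-- Morphisms of the center are the morphisms that commute with the half-braidings. -/
@[ext]
structure Hom (X Y : RightCenter C) where
  f : X.obj ⟶ Y.obj
  comm : ∀ V : C, V ◁ f ≫ (Y.σ V).hom = (X.σ V).hom ≫ f ▷ V

instance : Category (RightCenter C) where
  Hom := Hom
  id X := ⟨𝟙 X.obj, fun V => by simp⟩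
  comp f g := ⟨f.f ≫ g.f, fun V => by
    rw [MonoidalCategory.whiskerLeft_comp, MonoidalCategory.comp_whiskerRight, Category.assoc,
      g.comm, ← Category.assoc, f.comm, Category.assoc]⟩

@[ext]
theorem hom_ext {X Y : RightCenter C} {f g : X ⟶ Y} (h : f.f = g.f) : f = g := Hom.ext h

/-- The braiding `σ_{X,Y} : X ⊗ Y ≅ Y ⊗ X` of the center, on underlying objects. -/
def braiding (X Y : RightCenter C) : X.obj ⊗ Y.obj ≅ Y.obj ⊗ X.obj := Y.σ X.obj

end

variable {G : Type} [Group G] [Fintype G] {ω : ThreeCocycle G}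

instance : Limits.HasZeroMorphisms (RightCenter (VecG ω)) where
  zero X Y := ⟨⟨0, fun V => by
    apply VecG.hom_ext
    refine TensorProduct.ext' fun v x => ?_
    show (Y.σ V).hom.lin (v ⊗ₜ (0 : Y.obj.carrier)) =
      TensorProduct.map (0 : X.obj.carrier →ₗ[ℂ] Y.obj.carrier) LinearMap.id
        ((X.σ V).hom.lin (v ⊗ₜ x))
    rw [tmul_zero, TensorProduct.map_zero_left]
    exact map_zero _⟩⟩
  comp_zero {X Y} f Z := by
    apply hom_ext; apply VecG.hom_ext
    exact LinearMap.zero_comp _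
  zero_comp X {Y Z} f := by
    apply hom_ext; apply VecG.hom_ext
    exact LinearMap.comp_zero _

/-- The action `g ⊳ w`, determined by `σ (v ⊗ w) = (g ⊳ w) ⊗ v` for `v` of degree `g`. -/
def act (W : RightCenter (VecG ω)) (g : G) : W.obj.carrier →ₗ[ℂ] W.obj.carrier :=
  (TensorProduct.rid ℂ W.obj.carrier).toLinearMap ∘ₗ (W.σ (VecG.single ω g)).hom.lin ∘ₗ
    TensorProduct.mk ℂ ℂ W.obj.carrier 1

/-- `W` corresponds to the pair `(g, χ)`: the homogeneous component `W_g`, with the action of the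
centralizer of `g`, has (projective) character `χ`. The trace on `W_g` is the trace of the
action composed with the projection onto `W_g`. -/
def Affords (W : RightCenter (VecG ω)) (g : G) (χ : Subgroup.centralizer {g} → ℂ) : Prop :=
  ∀ c : Subgroup.centralizer {g}, LinearMap.trace ℂ W.obj.carrier (W.act c ∘ₗ W.obj.proj g) = χ c

end RightCenter

/-- The pivotal trace of an endomorphism: the canonical pivotal structure is the one for which
this is the ordinary trace of the underlying linear map. -/
def VecG.ptr {G : Type} [Group G] [Fintype G] {ω : ThreeCocycle G} {V : VecG ω} (f : V ⟶ V) : ℂ :=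
  LinearMap.trace ℂ V.carrier f.lin

namespace RightCenter
variable {G : Type} [Group G] [Fintype G] {ω : ThreeCocycle G}

/-- The twist `Θ(W)` of a simple object: the normalized trace of the kink `σ_{W,W}`, that is
the scalar with `ptr σ_{W,W} = Θ(W) dim W`. -/
def twist (W : RightCenter (VecG ω)) : ℂ :=
  VecG.ptr (braiding W W).hom / VecG.ptr (𝟙 W.obj)
end RightCenter

namespace RightCenter
variable {G : Type} [Group G] [Fintype G] {ω : ThreeCocycle G}

/-- The half-braiding in terms of the action: `σ (v ⊗ w) = (|v| ⊳ w) ⊗ v`. -/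
theorem σ_apply (W : RightCenter (VecG ω)) {V : VecG ω} {g : G} {v : V.carrier}
    (hv : V.IsHomog g v) (w : W.obj.carrier) :
    (W.σ V).hom.lin (v ⊗ₜ[ℂ] w) = W.act g w ⊗ₜ[ℂ] v := by
  let f : VecG.single ω g ⟶ V := VecG.Hom.mk' (LinearMap.toSpanSingleton ℂ V.carrier v) (by
    intro x (c : ℂ) hc
    rcases VecG.isHomog_single_eq hc with rfl | rfl
    · rw [LinearMap.toSpanSingleton_apply]
      exact (congrArg _ (zero_smul ℂ v)).trans ((map_zero _).trans (zero_smul ℂ v).symm)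
    · exact hv.smul c)
  have hn := congrArg VecG.Hom.lin (W.naturality f)
  have h1 := LinearMap.congr_fun hn ((1 : ℂ) ⊗ₜ[ℂ] w)
  have h2 : ∀ t : W.obj.carrier ⊗[ℂ] ℂ, TensorProduct.map LinearMap.id f.lin t =
      (TensorProduct.rid ℂ W.obj.carrier t) ⊗ₜ[ℂ] v := by
    intro t
    have : TensorProduct.map LinearMap.id f.lin = (TensorProduct.mk ℂ W.obj.carrier V.carrier).flip v
        ∘ₗ (TensorProduct.rid ℂ W.obj.carrier).toLinearMap := by
      refine TensorProduct.ext' fun x (c : ℂ) => ?_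
      show x ⊗ₜ[ℂ] (c • v) = (c • x) ⊗ₜ[ℂ] v
      rw [smul_tmul]
    exact LinearMap.congr_fun this t
  have h3 : (W.σ V).hom.lin (((1 : ℂ) • v) ⊗ₜ[ℂ] w) = TensorProduct.map LinearMap.id f.lin
    ((W.σ (VecG.single ω g)).hom.lin ((1 : ℂ) ⊗ₜ[ℂ] w)) := h1
  rw [one_smul] at h3
  rw [h3]
  exact h2 _

theorem isHomog_act (W : RightCenter (VecG ω)) {x : G} (g : G) {w : W.obj.carrier}
    (hw : W.obj.IsHomog x w) : W.obj.IsHomog (g * x * g⁻¹) (W.act g w) := by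
  have h1 := VecG.isHomog_single (ω := ω) g 1
  have h := VecG.IsHomog.map (W.σ (VecG.single ω g)).hom (h1.tmul hw)
  rw [σ_apply W h1] at h
  have h2 : (W.obj.tensor (VecG.single ω g)).proj (g * x) (W.act g w ⊗ₜ[ℂ] (1 : ℂ)) =
      W.obj.proj (g * x * g⁻¹) (W.act g w) ⊗ₜ[ℂ] (1 : ℂ) := by
    show (∑ a, TensorProduct.map (W.obj.proj a) ((VecG.single ω g).proj (a⁻¹ * (g * x)))) _ = _
    rw [LinearMap.sum_apply, Finset.sum_eq_single (g * x * g⁻¹)]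
    · rw [TensorProduct.map_tmul, show (g * x * g⁻¹)⁻¹ * (g * x) = g by group,
        show (VecG.single ω g).proj g (1 : ℂ) = 1 from h1]
    · intro b _ hb
      rw [TensorProduct.map_tmul, h1.proj_ne (fun h' => hb (by
        rw [eq_mul_inv_iff_mul_eq]; exact (inv_mul_eq_iff_eq_mul.mp h').symm)), tmul_zero]
    · simp
  have h3 := congrArg (TensorProduct.rid ℂ W.obj.carrier) (h2.symm.trans h)
  simpa [VecG.IsHomog] using h3

/-- The defining relation of the action: `x ⊳ (y ⊳ w) = α_{|w|}(x, y) (x y ⊳ w)`. -/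
theorem act_act (W : RightCenter (VecG ω)) (x y : G) {g : G} {w : W.obj.carrier}
    (hw : W.obj.IsHomog g w) :
    W.act x (W.act y w) = (ω.alpha g x y : ℂ) • W.act (x * y) w := by
  have h1 := LinearMap.congr_fun (congrArg VecG.Hom.lin
    (W.hexagon (VecG.single ω x) (VecG.single ω y))) (((1 : ℂ) ⊗ₜ[ℂ] (1 : ℂ)) ⊗ₜ[ℂ] w)
  have hx := VecG.isHomog_single (ω := ω) x 1
  have hy := VecG.isHomog_single (ω := ω) y 1
  have hyw := W.isHomog_act y hw
  have hxyw := W.isHomog_act x hyw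
  change (W.σ (VecG.tensor _ _)).hom.lin _ =
    VecG.assocHomLin W.obj (VecG.single ω x) (VecG.single ω y) (TensorProduct.map
      (W.σ (VecG.single ω x)).hom.lin LinearMap.id (VecG.assocInvLin (VecG.single ω x) W.obj
        (VecG.single ω y) (TensorProduct.map LinearMap.id (W.σ (VecG.single ω y)).hom.lin
          (VecG.assocHomLin (VecG.single ω x) (VecG.single ω y) W.obj _)))) at h1
  rw [W.σ_apply (hx.tmul hy), VecG.assocHomLin_apply hx hy hw, map_smul, TensorProduct.map_tmul,
    W.σ_apply hy, map_smul, LinearMap.id_apply, VecG.assocInvLin_apply hx hyw hy, smul_smul,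
    map_smul, TensorProduct.map_tmul, W.σ_apply hx, map_smul, LinearMap.id_apply,
    VecG.assocHomLin_apply hxyw hx hy, smul_smul] at h1
  have h2 := congrArg (fun t => (TensorProduct.rid ℂ W.obj.carrier)
    (TensorProduct.map LinearMap.id (TensorProduct.lid ℂ ℂ).toLinearMap t)) h1
  simp only [map_smul, TensorProduct.map_tmul, LinearMap.id_apply, LinearEquiv.coe_coe,
    TensorProduct.lid_tmul, TensorProduct.rid_tmul, smul_eq_mul, mul_one, one_smul] at h2
  rw [h2, smul_smul]
  have h3 : x * (y * g * y⁻¹) * x⁻¹ = x * y * g * (x * y)⁻¹ := by group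
  rw [h3]
  simp only [ThreeCocycle.alpha, Units.val_mul, Units.val_inv_eq_inv_val]
  have e1 := (ω.toFun x y g).ne_zero
  have e2 := (ω.toFun x (y * g * y⁻¹) y).ne_zero
  have e3 := (ω.toFun (x * y * g * (x * y)⁻¹) x y).ne_zero
  rw [show ∀ A B C : ℂ, A ≠ 0 → B ≠ 0 → C ≠ 0 → A * B⁻¹ * C * (A⁻¹ * B * C⁻¹) = 1 from
    fun A B C hA hB hC => by field_simp]
  · rw [one_smul]
  all_goals assumption

end RightCenter

/-! ### The group and the cocycle -/

section PQ

variable (p q : ℕ) [Fact p.Prime] [Fact q.Prime]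

instance {N H : Type} [Group N] [Group H] [Fintype N] [Fintype H] (φ : H →* MulAut N) :
    Fintype (N ⋊[φ] H) := Fintype.ofEquiv _ SemidirectProduct.equivProd.symm

variable {p q}

/-- The action of `ℤ/p` on `ℤ/q` for which `j` acts by multiplication by `n ^ j`. -/
def pqHom (n : (ZMod q)ˣ) (hn : n ^ p = 1) :
    Multiplicative (ZMod p) →* MulAut (Multiplicative (ZMod q)) where
  toFun j := AddEquiv.toMultiplicative (DistribMulAction.toAddEquiv (ZMod q) (n ^ j.toAdd.val))
  map_one' := by
    ext x
    simp
  map_mul' i j := by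
    have h : n ^ (i.toAdd + j.toAdd).val = n ^ i.toAdd.val * n ^ j.toAdd.val := by
      rw [ZMod.val_add, ← pow_add, ← pow_mod_orderOf n (_ % p),
        Nat.mod_mod_of_dvd _ (orderOf_dvd_of_pow_eq_one hn), pow_mod_orderOf]
    ext x
    simp [h, mul_smul]

/-- The group `ℤ/q ⋊ ℤ/p = ⟨a, b | a^q = b^p = 1, b a b⁻¹ = a^n⟩`. -/
abbrev PQ (n : (ZMod q)ˣ) (hn : n ^ p = 1) : Type :=
  Multiplicative (ZMod q) ⋊[pqHom n hn] Multiplicative (ZMod p)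

variable (n : (ZMod q)ˣ) (hn : n ^ p = 1)

/-- The generator `a`. -/
def PQ.a : PQ n hn := SemidirectProduct.inl (Multiplicative.ofAdd 1)
/-- The generator `b`. -/
def PQ.b : PQ n hn := SemidirectProduct.inr (Multiplicative.ofAdd 1)

/-- The representative `[j] ∈ {0, …, p - 1}` of the image `b^j` of `x` in `⟨b⟩`. -/
def PQ.bexp (x : PQ n hn) : ℕ := x.right.toAdd.val

/-- The representative in `{0, …, q - 1}` of the exponent `i` of `x = a^i b^j`. -/
def PQ.aexp (x : PQ n hn) : ℕ := x.left.toAdd.val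

theorem PQ.b_mul_a_mul_b_inv : PQ.b n hn * PQ.a n hn * (PQ.b n hn)⁻¹ =
    PQ.a n hn ^ (n : ZMod q).val := by
  have hp : 1 < p := (Fact.out : p.Prime).one_lt
  have : Fact (1 < p) := ⟨hp⟩
  unfold PQ.a PQ.b
  rw [← map_inv, ← SemidirectProduct.inl_aut, ← map_pow]
  congr 1
  simp [pqHom, ZMod.val_one, ← ofAdd_nsmul, Units.smul_def]

theorem carry_aux (i j k l : ZMod p) : ∃ m : ℤ,
    ((j.val : ℤ) * (k.val + l.val - (k + l).val) + i.val * ((j + k).val + l.val - (j + k + l).val)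
      + i.val * (j.val + k.val - (j + k).val)) =
    ((i + j).val * (k.val + l.val - (k + l).val) + i.val * (j.val + (k + l).val - (j + (k + l)).val))
      + p ^ 2 * m := by
  have key : ∀ a b : ZMod p, (a.val : ℤ) + b.val - (a + b).val = p * ((a.val + b.val) / p : ℕ) := by
    intro a b
    rw [ZMod.val_add]
    have := Nat.mod_add_div (a.val + b.val) p
    have h2 : (((a.val + b.val) % p : ℕ) : ℤ) + p * ((a.val + b.val) / p : ℕ) = a.val + b.val := by
      exact_mod_cast this
    linarith
  refine ⟨((i.val + j.val) / p : ℕ) * ((k.val + l.val) / p : ℕ), ?_⟩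
  have h1 := key i j
  have h2 := key k l
  rw [add_assoc j k l]
  linear_combination ((i.val : ℤ) + j.val - (i + j).val) * h2 + (p * ((k.val + l.val) / p : ℕ)) * h1

/-- The cocycle `ω` on `ℤ/q ⋊ ℤ/p`, inflated from `⟨b⟩`, raised to the power `u`:
`ω^u(x, y, z) = exp (2πi/p² [i] ([j] + [k] - [j + k])) ^ u` if `x, y, z` map to `b^i, b^j, b^k`. -/
def PQ.omega (u : ℤ) : ThreeCocycle (PQ n hn) where
  toFun x y z := Units.mk0 (Complex.exp (2 * Real.pi * Complex.I / p ^ 2 *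
    (PQ.bexp n hn x * (PQ.bexp n hn y + PQ.bexp n hn z - PQ.bexp n hn (y * z))))) 
      (Complex.exp_ne_zero _) ^ u
  cocycle x y z w := by
    simp only [← mul_zpow]
    congr 1
    ext
    simp only [Units.val_mul, Units.val_mk0, ← Complex.exp_add]
    rw [Complex.exp_eq_exp_iff_exists_int]
    obtain ⟨m, hm⟩ := carry_aux x.right.toAdd y.right.toAdd z.right.toAdd w.right.toAdd
    refine ⟨m, ?_⟩
    have hm' := congrArg (Int.cast : ℤ → ℂ) hm
    push_cast at hm'
    have hp : (p : ℂ) ≠ 0 := by exact_mod_cast (Fact.out : p.Prime).ne_zero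
    simp only [PQ.bexp, SemidirectProduct.mul_right, toAdd_mul]
    simp only [add_assoc] at hm' ⊢
    field_simp
    linear_combination hm'
  normalized x y := by
    have : Complex.exp (2 * Real.pi * Complex.I / p ^ 2 * (PQ.bexp n hn x *
        (PQ.bexp n hn 1 + PQ.bexp n hn y - PQ.bexp n hn (1 * y)))) = 1 := by
      simp [PQ.bexp]
    simp only [this, Units.mk0_one, one_zpow]

/-- `χ_q^s`, for the character `χ_q(a) = exp (2πi/q)` of `⟨a⟩`; only its values on `⟨a⟩` matter. -/
def PQ.chiQ (s : ℤ) (x : PQ n hn) : ℂ :=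
  Complex.exp (2 * Real.pi * Complex.I / q * (s * PQ.aexp n hn x))

/-- `χ_p^r`, for the character `χ_p(b) = exp (2πi/p)` of `⟨b⟩` (inflated to the whole group). -/
def PQ.chiP (r : ℤ) (x : PQ n hn) : ℂ :=
  Complex.exp (2 * Real.pi * Complex.I / p * (r * PQ.bexp n hn x))

/-- The cochain `μ` with coboundary `α_{b^k}`, for the cocycle `ω^u`. -/
def PQ.mu (u : ℤ) (k : ℕ) (x : PQ n hn) : ℂ :=
  Complex.exp (2 * Real.pi * Complex.I / p ^ 2 * (u * k * PQ.bexp n hn x))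

theorem PQ.bexp_b_pow (k : ℕ) (hk : k < p) : PQ.bexp n hn (PQ.b n hn ^ k) = k := by
  unfold PQ.b PQ.bexp
  rw [← map_pow, SemidirectProduct.right_inr, ← ofAdd_nsmul]
  simp [ZMod.val_natCast, Nat.mod_eq_of_lt hk]

/-- `α_{b^k} = dμ` on the centralizer of `b^k`. -/
theorem PQ.alpha_eq_coboundary (u : ℤ) (k : ℕ) (hk : k < p)
    (x y : PQ n hn) (hx : x ∈ Subgroup.centralizer {PQ.b n hn ^ k})
    (hy : y ∈ Subgroup.centralizer {PQ.b n hn ^ k}) :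
    ((PQ.omega n hn u).alpha (PQ.b n hn ^ k) x y : ℂ) =
      PQ.mu n hn u k x * PQ.mu n hn u k y / PQ.mu n hn u k (x * y) := by
  have conj : ∀ z ∈ Subgroup.centralizer {PQ.b n hn ^ k},
      z * PQ.b n hn ^ k * z⁻¹ = PQ.b n hn ^ k := fun z hz => by
    rw [Subgroup.mem_centralizer_singleton_iff.mp hz, mul_inv_cancel_right]
  rw [ThreeCocycle.alpha, conj y hy, conj _ (mul_mem hx hy)]
  simp only [PQ.omega, ← inv_zpow, ← mul_zpow, PQ.bexp_b_pow n hn k hk]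
  simp only [Units.val_zpow_eq_zpow_val, Units.val_mul, Units.val_inv_eq_inv_val, Units.val_mk0,
    ← Complex.exp_neg, ← Complex.exp_add, ← Complex.exp_int_mul, PQ.mu, ← Complex.exp_sub]
  congr 1
  have h : PQ.bexp n hn (y * PQ.b n hn ^ k) = PQ.bexp n hn (PQ.b n hn ^ k * y) := by
    simp [PQ.bexp, mul_comm]
  rw [h]
  ring

end PQ

end

/-!
For an object `W` of the center, `σ_{W,W}` sends `v ⊗ w` to `(|v| ⊳ w) ⊗ v`, so it is the sum over
`g` of the flip followed by `act g ⊗ proj g`. Since the flip followed by `A ⊗ B` has trace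
`tr (A B)` (`trace_map_comp_comm`), the pivotal trace of `σ_{W,W}` is the trace of the endomorphism
`w ↦ |w| ⊳ w` of `W` (`RightCenter.kink`, `RightCenter.trace_braiding`).

This endomorphism preserves degrees, and it commutes with the action because
`α_g(x g x⁻¹, x) = α_g(x, g)` for every three-cocycle. Its eigenspaces are therefore stable under the
grading and the action, and such a subspace carries a half-braiding restricted from `W`
(`RightCenter.restrict`, `RightCenter.exists_restrict_σ`). If `W` is simple, an eigenspace is thus
all of `W`, and `w ↦ |w| ⊳ w` is a scalar, which must be the twist. On the component of degree `g`
it is the action of `g`, so if `W` corresponds to `(g, χ)`, comparing traces on this component gives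
`Θ(W) = χ(g) / χ(1)` (`RightCenter.twist_eq_of_affords`). The three families of simple objects
differ only in the evaluation of this quotient.
-/

/-! ### The trace of a twisted flip -/

/-- The map `v ⊗ w ↦ f w ⊗ g v` has trace `tr (f g)`. -/
theorem trace_map_comp_comm {M : Type*} [AddCommGroup M] [Module ℂ M] [FiniteDimensional ℂ M]
    (f g : Module.End ℂ M) :
    LinearMap.trace ℂ (M ⊗[ℂ] M)
      (TensorProduct.map f g ∘ₗ (TensorProduct.comm ℂ M M).toLinearMap) =
      LinearMap.trace ℂ M (f ∘ₗ g) := by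
  classical
  let b := Module.finBasis ℂ M
  rw [LinearMap.trace_eq_matrix_trace ℂ (b.tensorProduct b), LinearMap.trace_eq_matrix_trace ℂ b,
    LinearMap.toMatrix_comp b b b]
  simp only [Matrix.trace, Matrix.diag, Fintype.sum_prod_type, Matrix.mul_apply,
    LinearMap.toMatrix_apply, LinearMap.comp_apply, Module.Basis.tensorProduct_apply,
    LinearEquiv.coe_coe, TensorProduct.comm_tmul, TensorProduct.map_tmul,
    Module.Basis.tensorProduct_repr_tmul_apply, smul_eq_mul]
  exact Finset.sum_congr rfl fun i _ => Finset.sum_congr rfl fun j _ => mul_comm _ _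

/-! ### Subobjects in the center -/

/-- A subobject `i : K ⟶ X` whose whiskerings are monomorphisms inherits a half-braiding from `X`
as soon as the half-braidings of `X` restrict to isomorphisms `V ⊗ K ≅ K ⊗ V`. -/
def RightCenter.restrict {C : Type*} [Category C] [MonoidalCategory C] (X : RightCenter C) {K : C}
    (i : K ⟶ X.obj) (σ : ∀ V : C, V ⊗ K ≅ K ⊗ V)
    (hσ : ∀ V, (σ V).hom ≫ i ▷ V = V ◁ i ≫ (X.σ V).hom) (hi : ∀ V : C, Mono (i ▷ V)) :
    RightCenter C where
  obj := K
  σ := σ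
  naturality {V V'} f := by
    rw [← cancel_mono (i ▷ V'), Category.assoc, hσ, Category.assoc, whisker_exchange,
      reassoc_of% hσ, ← X.naturality, whisker_exchange_assoc]
  hexagon U V := by
    rw [← cancel_mono (i ▷ (U ⊗ V)), hσ, X.hexagon]
    have h1 : U ◁ (σ V).hom ≫ U ◁ (i ▷ V) = U ◁ (V ◁ i) ≫ U ◁ (X.σ V).hom := by
      rw [← MonoidalCategory.whiskerLeft_comp, hσ, MonoidalCategory.whiskerLeft_comp]
    have h2 : (σ U).hom ▷ V ≫ (i ▷ U) ▷ V = (U ◁ i) ▷ V ≫ (X.σ U).hom ▷ V := by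
      rw [← comp_whiskerRight, hσ, comp_whiskerRight]
    simp only [Category.assoc]
    rw [← associator_naturality_left, reassoc_of% h2, ← associator_inv_naturality_middle_assoc,
      reassoc_of% h1, ← associator_naturality_right_assoc]

namespace VecG

variable {G : Type} [Group G] [Fintype G] {ω : ThreeCocycle G}

theorem mono_of_injective {V W : VecG ω} (f : V ⟶ W) (hf : Function.Injective f.lin) : Mono f where
  right_cancellation g h e := by
    apply hom_ext
    ext v
    exact hf (LinearMap.congr_fun (congrArg Hom.lin e) v)

theorem bijective_of_isIso {V W : VecG ω} (f : V ⟶ W) [IsIso f] : Function.Bijective f.lin :=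
  Function.bijective_iff_has_inverse.mpr ⟨(inv f).lin,
    fun v => LinearMap.congr_fun (congrArg Hom.lin (IsIso.hom_inv_id f)) v,
    fun v => LinearMap.congr_fun (congrArg Hom.lin (IsIso.inv_hom_id f)) v⟩

/-- A subspace stable under the projections onto the homogeneous components, as a graded space. -/
abbrev sub (V : VecG ω) (K : Submodule ℂ V.carrier) (hK : ∀ g, ∀ v ∈ K, V.proj g v ∈ K) :
    VecG ω where
  carrier := K
  proj g := (V.proj g).restrict (hK g)
  isProj := by
    rw [CompleteOrthogonalIdempotents.iff_ortho_complete]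
    refine ⟨fun g h hgh => ?_, ?_⟩
    · ext v
      exact LinearMap.congr_fun (V.isProj.ortho hgh) v
    · ext v
      simpa [LinearMap.sum_apply] using V.sum_proj (v : V.carrier)

/-- The inclusion of a graded subspace. -/
def subι (V : VecG ω) (K : Submodule ℂ V.carrier) (hK : ∀ g, ∀ v ∈ K, V.proj g v ∈ K) :
    V.sub K hK ⟶ V where
  lin := K.subtype
  comm _ := rfl

theorem isHomog_sub {V : VecG ω} {K : Submodule ℂ V.carrier} {hK : ∀ g, ∀ v ∈ K, V.proj g v ∈ K}
    {g : G} {v : K} : (V.sub K hK).IsHomog g v ↔ V.IsHomog g (v : V.carrier) :=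
  Subtype.ext_iff

end VecG

/-- The identity that makes `w ↦ |w| ⊳ w` commute with the action of `x`. -/
theorem ThreeCocycle.alpha_conj_left {G : Type} [Group G] (ω : ThreeCocycle G) (g x : G) :
    ω.alpha g (x * g * x⁻¹) x = ω.alpha g x g := by
  have h1 : g * g * g⁻¹ = g := by group
  have h2 : x * g * x⁻¹ * x * g * (x * g * x⁻¹ * x)⁻¹ = x * g * x⁻¹ := by group
  have h3 : x * g * g * (x * g)⁻¹ = x * g * x⁻¹ := by group
  rw [ThreeCocycle.alpha, ThreeCocycle.alpha, h1, h2, h3]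
  simp

namespace RightCenter

variable {G : Type} [Group G] [Fintype G] {ω : ThreeCocycle G}

/-- The half-braiding of `W` restricts to a subspace stable under the grading and the action. -/
theorem exists_restrict_σ (W : RightCenter (VecG ω)) (K : Submodule ℂ W.obj.carrier)
    (hK : ∀ g, ∀ v ∈ K, W.obj.proj g v ∈ K) (hact : ∀ g, ∀ v ∈ K, W.act g v ∈ K) (V : VecG ω) :
    ∃ e : V ⊗ W.obj.sub K hK ≅ W.obj.sub K hK ⊗ V,
      e.hom ≫ W.obj.subι K hK ▷ V = V ◁ W.obj.subι K hK ≫ (W.σ V).hom := by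
  classical
  let f : V.carrier ⊗[ℂ] K →ₗ[ℂ] K ⊗[ℂ] V.carrier :=
    ∑ g, TensorProduct.map ((W.act g).restrict (hact g)) (V.proj g) ∘ₗ
      (TensorProduct.comm ℂ V.carrier K).toLinearMap
  have hf : ∀ g v w, V.IsHomog g v → f (v ⊗ₜ w) = (W.act g).restrict (hact g) w ⊗ₜ v := by
    intro g v w hv
    simp only [f, LinearMap.sum_apply, LinearMap.comp_apply, LinearEquiv.coe_coe,
      TensorProduct.comm_tmul, TensorProduct.map_tmul]
    rw [Finset.sum_eq_single g]
    · rw [show V.proj g v = v from hv]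
    · intro x _ hx
      rw [hv.proj_ne hx, tmul_zero]
    · simp
  have hcomm : TensorProduct.map K.subtype LinearMap.id ∘ₗ f =
      (W.σ V).hom.lin ∘ₗ TensorProduct.map LinearMap.id K.subtype := by
    refine TensorProduct.ext <| VecG.linext fun g v hv => LinearMap.ext fun w => ?_
    show TensorProduct.map K.subtype LinearMap.id (f (v ⊗ₜ w)) =
      (W.σ V).hom.lin (v ⊗ₜ (w : W.obj.carrier))
    rw [hf g v w hv, W.σ_apply hv]
    rfl
  -- `f` is a restriction of an isomorphism, hence injective, hence bijective by dimension.
  have hinj : Function.Injective f := by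
    have h : Function.Injective (TensorProduct.map K.subtype LinearMap.id ∘ₗ f) := by
      rw [hcomm, LinearMap.coe_comp]
      exact (VecG.bijective_of_isIso (W.σ V).hom).injective.comp
        (Module.Flat.lTensor_preserves_injective_linearMap (M := V.carrier) K.subtype
          K.injective_subtype)
    rw [LinearMap.coe_comp] at h
    exact h.of_comp
  let e := f.linearEquivOfInjective hinj
    (TensorProduct.comm ℂ V.carrier K).finrank_eq
  refine ⟨VecG.isoOfEquiv (V := VecG.tensor V (W.obj.sub K hK))
    (W := VecG.tensor (W.obj.sub K hK) V) e ?_, ?_⟩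
  · intro g
    refine VecG.linext₂ (V := W.obj.sub K hK) fun x y v w hv hw => ?_
    have hw' : (W.obj.sub K hK).IsHomog (x * y * x⁻¹) ((W.act x).restrict (hact x) w) :=
      VecG.isHomog_sub.mpr (W.isHomog_act x (VecG.isHomog_sub.mp hw))
    show f ((VecG.tensor V (W.obj.sub K hK)).proj g (v ⊗ₜ w)) =
      (VecG.tensor (W.obj.sub K hK) V).proj g (f (v ⊗ₜ w))
    rw [hf x v w hv, VecG.proj_tmul hv hw, VecG.proj_tmul hw' hv, inv_mul_cancel_right]
    split_ifs
    · exact hf x v w hv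
    · exact map_zero f
  · exact VecG.hom_ext hcomm

/-- In a simple object, a nonzero subspace stable under the grading and the action is everything. -/
theorem eq_top_of_simple (W : RightCenter (VecG ω)) [Simple W] (K : Submodule ℂ W.obj.carrier)
    (hK : ∀ g, ∀ v ∈ K, W.obj.proj g v ∈ K) (hact : ∀ g, ∀ v ∈ K, W.act g v ∈ K) (h0 : K ≠ ⊥) :
    K = ⊤ := by
  choose e he using W.exists_restrict_σ K hK hact
  let Y : RightCenter (VecG ω) := W.restrict (W.obj.subι K hK) e he fun V =>
    VecG.mono_of_injective _ (Module.Flat.rTensor_preserves_injective_linearMap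
      (M := V.carrier) K.subtype K.injective_subtype)
  let i : Y ⟶ W := ⟨W.obj.subι K hK, fun V => (he V).symm⟩
  have : Mono i := ⟨fun {Z} g h hgh => hom_ext <| by
    have := VecG.mono_of_injective (W.obj.subι K hK) K.injective_subtype
    exact (cancel_mono (W.obj.subι K hK)).mp (congrArg Hom.f hgh)⟩
  have hi : i ≠ 0 := fun h => h0 <| (Submodule.eq_bot_iff K).mpr fun v hv =>
    LinearMap.congr_fun (congrArg (fun f : Y ⟶ W => f.f.lin) h) (⟨v, hv⟩ : K)
  have := isIso_of_mono_of_nonzero hi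
  have : IsIso (W.obj.subι K hK) := ⟨(inv i).f, congrArg Hom.f (IsIso.hom_inv_id i),
    congrArg Hom.f (IsIso.inv_hom_id i)⟩
  rw [← K.range_subtype]
  exact LinearMap.range_eq_top.mpr (VecG.bijective_of_isIso (W.obj.subι K hK)).surjective

/-! ### The twist as a central endomorphism -/

/-- The central endomorphism `w ↦ |w| ⊳ w`. -/
noncomputable def kink (W : RightCenter (VecG ω)) : Module.End ℂ W.obj.carrier :=
  ∑ g, W.act g ∘ₗ W.obj.proj g

theorem kink_apply (W : RightCenter (VecG ω)) {g : G} {w : W.obj.carrier}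
    (hw : W.obj.IsHomog g w) : W.kink w = W.act g w := by
  rw [kink, LinearMap.sum_apply, Finset.sum_eq_single g]
  · rw [LinearMap.comp_apply, show W.obj.proj g w = w from hw]
  · intro x _ hx
    rw [LinearMap.comp_apply, hw.proj_ne hx, map_zero]
  · simp

theorem kink_proj (W : RightCenter (VecG ω)) (g : G) (w : W.obj.carrier) :
    W.kink (W.obj.proj g w) = W.obj.proj g (W.kink w) := by
  classical
  refine LinearMap.congr_fun (f := W.kink ∘ₗ W.obj.proj g) (g := W.obj.proj g ∘ₗ W.kink)
    (VecG.linext fun x v hv => ?_) w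
  have hk : W.obj.IsHomog x (W.kink v) := by
    have := W.isHomog_act x hv
    rwa [mul_inv_cancel_right, ← W.kink_apply hv] at this
  rw [LinearMap.comp_apply, LinearMap.comp_apply, hv.proj_apply, hk.proj_apply]
  split_ifs
  · rfl
  · exact map_zero _

theorem kink_act (W : RightCenter (VecG ω)) (x : G) (w : W.obj.carrier) :
    W.kink (W.act x w) = W.act x (W.kink w) := by
  refine LinearMap.congr_fun (f := W.kink ∘ₗ W.act x) (g := W.act x ∘ₗ W.kink)
    (VecG.linext fun g v hv => ?_) w
  rw [LinearMap.comp_apply, LinearMap.comp_apply, W.kink_apply hv,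
    W.kink_apply (W.isHomog_act x hv), W.act_act _ _ hv, W.act_act _ _ hv,
    ω.alpha_conj_left, inv_mul_cancel_right]

/-- Schur's lemma for `w ↦ |w| ⊳ w`. -/
theorem exists_kink_eq_smul (W : RightCenter (VecG ω)) [Simple W] [Nontrivial W.obj.carrier] :
    ∃ c : ℂ, W.kink = c • LinearMap.id := by
  obtain ⟨c, hc⟩ := Module.End.exists_eigenvalue W.kink
  refine ⟨c, ?_⟩
  have h := W.eq_top_of_simple (Module.End.eigenspace W.kink c)
    (fun g v hv => by
      rw [Module.End.mem_eigenspace_iff] at hv ⊢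
      rw [kink_proj, hv, map_smul])
    (fun g v hv => by
      rw [Module.End.mem_eigenspace_iff] at hv ⊢
      rw [kink_act, hv, map_smul]) hc
  ext v
  exact Module.End.mem_eigenspace_iff.mp (h ▸ Submodule.mem_top : v ∈ _)

theorem trace_braiding (W : RightCenter (VecG ω)) :
    VecG.ptr (braiding W W).hom = LinearMap.trace ℂ W.obj.carrier W.kink := by
  have h : (W.σ W.obj).hom.lin = ∑ g, TensorProduct.map (W.act g) (W.obj.proj g) ∘ₗ
      (TensorProduct.comm ℂ W.obj.carrier W.obj.carrier).toLinearMap := by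
    refine TensorProduct.ext <| VecG.linext fun g v hv => LinearMap.ext fun w => ?_
    show (W.σ W.obj).hom.lin (v ⊗ₜ w) = (∑ g, TensorProduct.map (W.act g) (W.obj.proj g) ∘ₗ
      (TensorProduct.comm ℂ W.obj.carrier W.obj.carrier).toLinearMap) (v ⊗ₜ w)
    rw [W.σ_apply hv, LinearMap.sum_apply, Finset.sum_eq_single g]
    · rw [LinearMap.comp_apply, LinearEquiv.coe_coe, TensorProduct.comm_tmul,
        TensorProduct.map_tmul, show W.obj.proj g v = v from hv]
    · intro x _ hx
      rw [LinearMap.comp_apply, LinearEquiv.coe_coe, TensorProduct.comm_tmul,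
        TensorProduct.map_tmul, hv.proj_ne hx, tmul_zero]
    · simp
  show LinearMap.trace ℂ (W.obj.carrier ⊗[ℂ] W.obj.carrier) (W.σ W.obj).hom.lin = _
  rw [h, map_sum, kink, map_sum]
  exact Finset.sum_congr rfl fun g _ => trace_map_comp_comm _ _

theorem act_one (W : RightCenter (VecG ω)) : W.act 1 = LinearMap.id := by
  -- `act 1` is idempotent because `α_g(1, 1) = 1`, so injectivity makes it the identity.
  have hinj : Function.Injective (W.act 1) := by
    intro v w h
    have h1 := VecG.isHomog_single (ω := ω) 1 1
    have h2 : (W.σ (VecG.single ω 1)).hom.lin ((1 : ℂ) ⊗ₜ[ℂ] v) =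
        (W.σ (VecG.single ω 1)).hom.lin ((1 : ℂ) ⊗ₜ[ℂ] w) := by
      rw [W.σ_apply h1, W.σ_apply h1, h]
    have h3 := (VecG.bijective_of_isIso (W.σ (VecG.single ω 1)).hom).injective h2
    simpa using congrArg (TensorProduct.lid ℂ W.obj.carrier) h3
  refine VecG.linext fun g v hv => hinj ?_
  have hα : ω.alpha g 1 1 = 1 := by
    -- The cocycle condition at `(1, 1, g, 1)` gives `ω(1, g, 1) = 1`.
    have h1 := ω.cocycle 1 1 g 1
    simp only [ω.normalized, one_mul, mul_one] at h1
    simp [ThreeCocycle.alpha, ω.normalized, mul_eq_left.mp h1]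
  rw [W.act_act 1 1 hv, hα, Units.val_one, one_smul, mul_one, LinearMap.id_apply]

/-- The twist of a simple object with character `χ` in degree `g` is `χ(g) / χ(1)`. -/
theorem twist_eq_of_affords (W : RightCenter (VecG ω)) [Simple W] {g : G}
    {χ : Subgroup.centralizer {g} → ℂ} (h : W.Affords g χ) (h1 : χ 1 ≠ 0) :
    W.twist = χ ⟨g, Subgroup.mem_centralizer_singleton_iff.mpr rfl⟩ / χ 1 := by
  have hχ1 : LinearMap.trace ℂ W.obj.carrier (W.obj.proj g) = χ 1 := by
    rw [← h 1, OneMemClass.coe_one, act_one, LinearMap.id_comp]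
  have : Nontrivial W.obj.carrier := by
    by_contra hW
    rw [not_nontrivial_iff_subsingleton] at hW
    exact h1 (by rw [← hχ1, Subsingleton.elim (W.obj.proj g) 0, map_zero])
  obtain ⟨c, hc⟩ := W.exists_kink_eq_smul
  have hχg : χ ⟨g, Subgroup.mem_centralizer_singleton_iff.mpr rfl⟩ = c * χ 1 := by
    have hg : W.act g ∘ₗ W.obj.proj g = c • W.obj.proj g := by
      ext w
      rw [LinearMap.comp_apply, ← W.kink_apply (W.obj.isHomog_proj g w), hc]
      rfl
    rw [← h, ← hχ1, hg, map_smul, smul_eq_mul]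
  have hdim : LinearMap.trace ℂ W.obj.carrier LinearMap.id ≠ 0 := by
    rw [LinearMap.trace_id]
    exact_mod_cast Module.finrank_pos.ne'
  rw [hχg, mul_div_cancel_right₀ _ h1, twist, trace_braiding, hc, map_smul, smul_eq_mul]
  exact mul_div_cancel_right₀ _ hdim

end RightCenter

/-! ### The values of the characters -/

namespace PQ

variable {p q : ℕ} [Fact p.Prime] [Fact q.Prime] (n : (ZMod q)ˣ) (hn : n ^ p = 1)

theorem bexp_one : PQ.bexp n hn 1 = 0 := by
  simp [PQ.bexp]

theorem aexp_one : PQ.aexp n hn 1 = 0 := by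
  simp [PQ.aexp]

theorem aexp_a_pow (l : ℕ) : PQ.aexp n hn (PQ.a n hn ^ l) = l % q := by
  unfold PQ.a PQ.aexp
  rw [← map_pow, SemidirectProduct.left_inl, ← ofAdd_nsmul]
  simp [ZMod.val_natCast]

/-- `χ_q^s` is defined through the representative `l % q` of the exponent, but `l` itself gives the
same value. -/
theorem chiQ_a_pow (s : ℤ) (l : ℕ) : PQ.chiQ n hn s (PQ.a n hn ^ l) =
    Complex.exp (2 * Real.pi * Complex.I / q * (s * l)) := by
  rw [PQ.chiQ, aexp_a_pow, Complex.exp_eq_exp_iff_exists_int]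
  obtain ⟨m, hm⟩ : ∃ m, l % q + q * m = l := ⟨l / q, Nat.mod_add_div l q⟩
  refine ⟨-(s * m), ?_⟩
  have hq : (q : ℂ) ≠ 0 := by exact_mod_cast (Fact.out : q.Prime).ne_zero
  have h : ((l % q : ℕ) : ℂ) + q * m = l := by exact_mod_cast hm
  rw [← h]
  push_cast
  field_simp
  ring

end PQ

theorem FDRep.character_one_ne_zero_of_simple {G : Type} [Group G] (ρ : FDRep ℂ G) [Simple ρ] :
    ρ.character 1 ≠ 0 := by
  rw [FDRep.char_one, Nat.cast_ne_zero]
  intro h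
  have : Subsingleton ρ := Module.finrank_zero_iff.mp h
  exact id_nonzero ρ (ConcreteCategory.hom_ext _ _ fun x => Subsingleton.elim (α := ρ) _ _)

/-! ### The twists of the simple objects -/

theorem mainTheorem7 (p q : ℕ) [Fact p.Prime] [Fact q.Prime] (hp : Odd p) (hq : Odd q)
    (hpq : p ∣ q - 1) (n : (ZMod q)ˣ) (hn1 : n ≠ 1) (hn : n ^ p = 1) (u : ℤ) :
    (∀ W : RightCenter (VecG (PQ.omega n hn u)), CategoryTheory.Simple W →
      ∀ ρ : FDRep ℂ (PQ n hn), CategoryTheory.Simple ρ →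
        W.Affords 1 (fun c => ρ.character (c : PQ n hn)) → W.twist = 1) ∧
    (∀ W : RightCenter (VecG (PQ.omega n hn u)), CategoryTheory.Simple W →
      ∀ (l : ℕ) (s : ℤ), ¬ q ∣ l →
        W.Affords (PQ.a n hn ^ l) (fun c => PQ.chiQ n hn s (c : PQ n hn)) →
          W.twist = Complex.exp (2 * Real.pi * Complex.I / q * (s * l))) ∧
    (∀ W : RightCenter (VecG (PQ.omega n hn u)), CategoryTheory.Simple W →
      ∀ (k : ℕ) (r : ℤ), 0 < k → k < p →
        W.Affords (PQ.b n hn ^ k)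
          (fun c => PQ.chiP n hn r (c : PQ n hn) * PQ.mu n hn u k (c : PQ n hn)) →
          W.twist = Complex.exp (2 * Real.pi * Complex.I / (p : ℂ) ^ 2 *
            (p * k * r + (k : ℂ) ^ 2 * u)) ∧
          W.twist ^ p = Complex.exp (2 * Real.pi * Complex.I / p) ^ ((k : ℤ) ^ 2 * u)) := by
  have hp0 : (p : ℂ) ≠ 0 := by exact_mod_cast (Fact.out : p.Prime).ne_zero
  refine ⟨fun W _ ρ hρ h => ?_, fun W _ l s _ h => ?_, fun W _ k r _ hk h => ?_⟩
  · have h1 := ρ.character_one_ne_zero_of_simple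
    exact (W.twist_eq_of_affords h h1).trans (div_self h1)
  · rw [W.twist_eq_of_affords h (Complex.exp_ne_zero _), PQ.chiQ_a_pow]
    simp [PQ.chiQ, PQ.aexp_one]
  · have ht : W.twist = Complex.exp (2 * Real.pi * Complex.I / (p : ℂ) ^ 2 *
        (p * k * r + (k : ℂ) ^ 2 * u)) := by
      rw [W.twist_eq_of_affords h (mul_ne_zero (Complex.exp_ne_zero _) (Complex.exp_ne_zero _))]
      simp only [PQ.chiP, PQ.mu, OneMemClass.coe_one, PQ.bexp_one, PQ.bexp_b_pow n hn k hk,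
        Nat.cast_zero, mul_zero, Complex.exp_zero, mul_one, div_one]
      rw [← Complex.exp_add]
      congr 1
      field_simp
    refine ⟨ht, ?_⟩
    rw [ht, ← Complex.exp_nat_mul, ← Complex.exp_int_mul, Complex.exp_eq_exp_iff_exists_int]
    -- The two exponents differ by `2πi k r`.
    refine ⟨k * r, ?_⟩
    push_cast
    field_simp
    ring
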